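/- Let $\mathbb{B}=\{v\in\mathbb{R}^d:\|v\|_2\le 1\}$. A protocol for vector aggregation with $n$ users in the single-message shuffle model is a pair $(\mathcal{A},\mathcal{R})$ consisting of a local randomizer $\mathcal{R}$, a randomized map $\mathbb{B}\to\mathcal{Z}$ into some message space $\mathcal{Z}$, and an aggregation function $\mathcal{A}:\mathcal{Z}^n\to\mathbb{R}^d$. On inputs $v_1,\dots,v_n\in\mathbb{B}$ each user $i$ independently draws a single message $\mathcal{R}(v_i)$, the shuffler $\Pi$ applies a uniformly random permutation to the $n$ messages, and the output is $\mathcal{A}(\Pi(\mathcal{R}(v_1),\dots,\mathcal{R}(v_n)))$. The protocol is $(\varepsilon,\delta)$-DP if for all inputs $(v_1,\dots,v_n)$ and $(v_1',\dots,v_n')$ that differ in the vector of at most one user and all measurable $U\subseteq\mathcal{Z}^n$, \[\Pr[\Pi(\mathcal{R}(v_1),\dots,\mathcal{R}(v_n))\in U]\le e^{\varepsilon}\Pr[\Pi(\mathcal{R}(v_1'),\dots,\mathcal{R}(v_n'))\in U]+\delta,\] and its mean squared error is \[\sup_{v_1,\dots,v_n\in\mathbb{B}}\mathbb{E}\Big[\Big\|\mathcal{A}(\Pi(\mathcal{R}(v_1),\dots,\mathcal{R}(v_n)))-\sum_{i=1}^n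 v_i\Big\|_2^2\Big].\] Theorem. For every $\delta\in(0,1)$ there is a constant $C_\delta>0$, depending only on $\delta$, such that for all $\varepsilon\in(0,1)$ and all $d,n\in\mathbb{N}$ there is an $(\varepsilon,\delta)$-DP protocol for vector aggregation with $n$ users in the single-message shuffle model whose mean squared error is at most \[C_\delta\, d\, n^{d/(d+2)}\,\varepsilon^{-4/(d+2)}.\] -/

import Mathlib

open MeasureTheory ProbabilityTheory

/-- The closed unit ball of `ℝ^d` with the Euclidean norm: the set of possible inputs of a user. -/
abbrev InputVec (d : ℕ) : Type := Metric.closedBall (0 : EuclideanSpace ℝ (Fin d)) 1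

/-- Two datasets of `n` users are neighboring if they differ in the input of at most one user. -/
def Neighboring {n : ℕ} {X : Type*} (x y : Fin n → X) : Prop :=
  ∃ i, ∀ j, j ≠ i → x j = y j

/-- `(ε, δ)`-differential privacy of a randomized algorithm on datasets of `n` users; the algorithm
is given by the law `M x` of its output on each dataset `x`. -/
def IsDP {n : ℕ} {X Y : Type*} [MeasurableSpace Y]
    (M : (Fin n → X) → Measure Y) (ε δ : ℝ) : Prop :=
  ∀ x y, Neighboring x y → ∀ U, MeasurableSet U →
    M x U ≤ ENNReal.ofReal (Real.exp ε) * M y U + ENNReal.ofReal δ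

/-- The shuffler: it applies a uniformly random permutation to a (random) tuple of messages, whose
law is `μ`. -/
noncomputable def shuffle {n : ℕ} {Z : Type*} [MeasurableSpace Z] (μ : Measure (Fin n → Z)) :
    Measure (Fin n → Z) :=
  (n.factorial : ENNReal)⁻¹ • ∑ σ : Equiv.Perm (Fin n), μ.map (fun z i => z (σ i))

/-- A protocol for the aggregation of `n` vectors in the unit ball of `ℝ^d` in the single-message shuffle
model: a local randomizer, which every user applies, with fresh private randomness, to its own
vector to produce one message, and an aggregation function, which is applied to the `n` shuffled
messages. -/
structure SingleMessageProtocol (d n : ℕ) where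
  /-- The message space. -/
  Message : Type
  [measurableSpace : MeasurableSpace Message]
  [standardBorelSpace : StandardBorelSpace Message]
  /-- The local randomizer; `randomizer v` is the law of the message sent on input `v`. -/
  randomizer : Kernel (InputVec d) Message
  [isMarkovKernel : IsMarkovKernel randomizer]
  /-- The aggregation function. -/
  aggregator : (Fin n → Message) → EuclideanSpace ℝ (Fin d)
  measurable_aggregator : Measurable aggregator

namespace SingleMessageProtocol

attribute [instance] measurableSpace standardBorelSpace isMarkovKernel

variable {d n : ℕ} (P : SingleMessageProtocol d n)

/-- The law of the shuffled messages on the inputs `v 0, …, v (n - 1)`; the users randomize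
independently of each other. -/
noncomputable def shuffledMessages (v : Fin n → InputVec d) : Measure (Fin n → P.Message) :=
  shuffle (Measure.pi fun i => P.randomizer (v i))

/-- A protocol is `(ε, δ)`-shuffle DP if the algorithm that outputs the shuffled messages is
`(ε, δ)`-DP. -/
def IsShuffleDP (ε δ : ℝ) : Prop := IsDP P.shuffledMessages ε δ

/-- The mean squared error: the supremum, over all inputs, of the expected squared Euclidean
distance of the output of the protocol from the sum of the inputs. It may be `∞`. -/
noncomputable def mse : ENNReal :=
  ⨆ v : Fin n → InputVec d,
    ∫⁻ z, ‖P.aggregator z - ∑ i, (v i : EuclideanSpace ℝ (Fin d))‖ₑ ^ 2 ∂(P.shuffledMessages v)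

end SingleMessageProtocol

/-! ### Finite product distributions -/

section ProductWeights

variable {ι α : Type*} [Fintype ι] [DecidableEq ι] [Fintype α]

/-! Since the constant may depend on `δ` and `ε ^ (-4/(d+2)) ≥ 1`, it suffices to reach error `O_δ(d
n^(d/(d+2)))` with `(0, δ)`-DP. Each user rounds its vector, without bias, to one of `B` fixed
points, and with probability `γ` sends a uniformly random point instead; the analyzer adds debiased
estimates.

Privacy (`sum_test_le_add`): the shuffled output is as informative as symmetric tests. About `nγ`
users form a uniform blanket, in which each point occurs about `nγ/B` times with fluctuations of
order `√(nγ/B)`. Changing one message moves two counts by one, so the total variation is of order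
`√(B/(nγ))`; the precise sufficient condition is `2B ≤ nγδ²`.

Error (`Rounding.mse_protocol_le`): the estimates are independent and unbiased, so variances add up
to at most `16n(s² + γr²)`, with `s` the rounding distance and `r` the largest distance from an
input to a point.

Put `t = n^(1/(d+2))`, so `n = t^d t²`. A grid with `⌊t⌋` points per axis has `B ≤ t^d`, `s² =
O(d/t²)` and `r² = O(d)`. With `nγ = 2B/δ²` both error terms are `O_δ(d t^d)`. If `t` is bounded in
terms of `δ`, then `n = O_δ(t^d)` and error `O_δ(dn)` is enough: the `2d` vertices of a
cross-polytope give it when `n ≥ 8d/δ²`, and the constant answer `0` does otherwise. -/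

theorem sum_prod_mul_prod (q ψ : ι → α → ℝ) :
    ∑ z : ι → α, (∏ j, q j (z j)) * ∏ j, ψ j (z j) = ∏ j, ∑ a, q j a * ψ j a := by
  rw [Finset.prod_univ_sum, Fintype.piFinset_univ]
  exact Finset.sum_congr rfl fun z _ => Finset.prod_mul_distrib.symm

theorem sum_prod_eq_one {q : ι → α → ℝ} (hq : ∀ j, ∑ a, q j a = 1) :
    ∑ z : ι → α, ∏ j, q j (z j) = 1 := by
  have h := sum_prod_mul_prod q fun _ _ => 1
  simpa [hq] using h

theorem sum_prod_mul_eval {q : ι → α → ℝ} (hq : ∀ j, ∑ a, q j a = 1) (i : ι) (φ : α → ℝ) :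
    ∑ z : ι → α, (∏ j, q j (z j)) * φ (z i) = ∑ a, q i a * φ a := by
  have h := sum_prod_mul_prod q fun j a => if j = i then φ a else 1
  simp only [Finset.prod_ite_eq', Finset.mem_univ, if_true] at h
  rw [h, Finset.prod_eq_single i]
  · simp
  · intro j _ hj
    simp [hj, hq]
  · simp

theorem sum_prod_mul_eval_mul_eval {q : ι → α → ℝ} {i k : ι}
    (hik : i ≠ k) (φ ψ : α → ℝ) (hφ : ∑ a, q i a * φ a = 0) :
    ∑ z : ι → α, (∏ j, q j (z j)) * (φ (z i) * ψ (z k)) = 0 := by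
  have h := sum_prod_mul_prod q
    fun j a => (if j = i then φ a else 1) * (if j = k then ψ a else 1)
  simp only [Finset.prod_mul_distrib, Finset.prod_ite_eq', Finset.mem_univ, if_true] at h
  rw [h, Finset.prod_eq_zero (Finset.mem_univ i)]
  simpa [hik] using hφ

/-- The second moment of a sum of independent centered variables. -/
theorem sum_prod_mul_sum_sq {q φ : ι → α → ℝ} (hq : ∀ j, ∑ a, q j a = 1)
    (hφ : ∀ j, ∑ a, q j a * φ j a = 0) :
    ∑ z : ι → α, (∏ j, q j (z j)) * (∑ j, φ j (z j)) ^ 2 = ∑ j, ∑ a, q j a * φ j a ^ 2 := by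
  have h1 : ∀ z : ι → α, (∏ j, q j (z j)) * (∑ j, φ j (z j)) ^ 2
      = ∑ i, ∑ k, (∏ j, q j (z j)) * (φ i (z i) * φ k (z k)) := by
    intro z
    rw [sq, Finset.sum_mul_sum, Finset.mul_sum]
    exact Finset.sum_congr rfl fun i _ => Finset.mul_sum _ _ _
  simp_rw [h1]
  rw [Finset.sum_comm]
  refine Finset.sum_congr rfl fun i _ => ?_
  rw [Finset.sum_comm, Finset.sum_eq_single i]
  · rw [← sum_prod_mul_eval hq i fun a => φ i a ^ 2]
    exact Finset.sum_congr rfl fun z _ => by rw [sq]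
  · intro k _ hk
    exact sum_prod_mul_eval_mul_eval hk.symm _ _ (hφ i)
  · simp

/-- Exchangeability: relabelling two identically distributed users preserves the product law. -/
theorem sum_comp_swap_mul_prod {q : ι → α → ℝ} {i k : ι} (h : q i = q k) (F : (ι → α) → ℝ) :
    ∑ z : ι → α, F (z ∘ Equiv.swap i k) * ∏ j, q j (z j) = ∑ z, F z * ∏ j, q j (z j) := by
  rw [← Equiv.sum_comp ((Equiv.swap i k).arrowCongr (Equiv.refl α))
    fun z => F z * ∏ j, q j (z j)]
  refine Finset.sum_congr rfl fun z _ => ?_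
  have h2 : ∀ j, q (Equiv.swap i k j) = q j := by
    intro j
    rcases eq_or_ne j i with rfl | hi
    · rw [Equiv.swap_apply_left, h]
    rcases eq_or_ne j k with rfl | hk
    · rw [Equiv.swap_apply_right, h]
    · rw [Equiv.swap_apply_of_ne_of_ne hi hk]
  congr 1
  rw [← Equiv.prod_comp (Equiv.swap i k)]
  refine Finset.prod_congr rfl fun j _ => ?_
  simp [h2]

end ProductWeights

/-! ### The privacy blanket -/

/-- The expectation of `1 / (N + 1)`, for `N` with a binomial law, is at most
`1 / ((m + 1) γ)`. -/
theorem sum_powerset_div_card_le {ι : Type*} {E : Finset ι} {γ : ℝ} (h1 : γ ≤ 1) :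
    (E.card + 1) * γ *
      ∑ S ∈ E.powerset, γ ^ S.card * (1 - γ) ^ (E.card - S.card) * ((S.card : ℝ) + 1)⁻¹ ≤ 1 := by
  set m := E.card with hm
  rw [Finset.sum_powerset_apply_card
    (fun k => γ ^ k * (1 - γ) ^ (m - k) * ((k : ℝ) + 1)⁻¹), Finset.mul_sum, ← hm]
  -- By `(m+1) C(m,k) = (k+1) C(m+1,k+1)`, the sum becomes the binomial expansion of `(γ + (1 -
  -- γ))^(m+1)` without its zeroth term.
  have h2 : ∀ k ∈ Finset.range (m + 1), ((m : ℝ) + 1) * γ *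
      (m.choose k • (γ ^ k * (1 - γ) ^ (m - k) * ((k : ℝ) + 1)⁻¹))
      = γ ^ (k + 1) * (1 - γ) ^ (m + 1 - (k + 1)) * ((m + 1).choose (k + 1) : ℝ) := by
    intro k _
    have h3 : ((m : ℝ) + 1) * m.choose k = (m + 1).choose (k + 1) * ((k : ℝ) + 1) := by
      exact_mod_cast Nat.add_one_mul_choose_eq m k
    have h4 : (k : ℝ) + 1 ≠ 0 := by positivity
    rw [nsmul_eq_mul, Nat.add_sub_add_right, pow_succ]
    calc _ = γ ^ k * γ * (1 - γ) ^ (m - k) * (((m : ℝ) + 1) * m.choose k) * ((k : ℝ) + 1)⁻¹ := by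
          ring
      _ = _ := by
          rw [h3]
          field_simp
  rw [Finset.sum_congr rfl h2]
  have h5 := add_pow γ (1 - γ) (m + 1)
  rw [add_sub_cancel, one_pow, Finset.sum_range_succ'] at h5
  have h6 : 0 ≤ γ ^ 0 * (1 - γ) ^ (m + 1 - 0) * ((m + 1).choose 0 : ℝ) := by
    have : 0 ≤ 1 - γ := by linarith
    positivity
  linarith

theorem sum_powerset_pow_mul_pow {ι : Type*} (E : Finset ι) (γ : ℝ) :
    ∑ S ∈ E.powerset, γ ^ S.card * (1 - γ) ^ (E.card - S.card) = 1 := by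
  rw [Finset.sum_pow_mul_eq_add_pow]
  simp

/-! ### Mixtures with the uniform distribution -/

section BlanketWeight

variable {α : Type*} [Fintype α]

/-- The distribution `w`, replaced by the uniform distribution with probability `γ`. -/
noncomputable def blanketWeight (γ : ℝ) (w : α → ℝ) (a : α) : ℝ :=
  γ * (Fintype.card α : ℝ)⁻¹ + (1 - γ) * w a

theorem blanketWeight_nonneg {γ : ℝ} (h0 : 0 ≤ γ) (h1 : γ ≤ 1) {w : α → ℝ} {a : α}
    (hw : 0 ≤ w a) : 0 ≤ blanketWeight γ w a := by
  have : 0 ≤ 1 - γ := by linarith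
  unfold blanketWeight
  positivity

theorem sum_blanketWeight_mul (γ : ℝ) (w φ : α → ℝ) :
    ∑ a, blanketWeight γ w a * φ a
      = γ * ((Fintype.card α : ℝ)⁻¹ * ∑ a, φ a) + (1 - γ) * ∑ a, w a * φ a := by
  simp only [blanketWeight, add_mul, Finset.sum_add_distrib, Finset.mul_sum, mul_assoc]

theorem sum_blanketWeight [Nonempty α] (γ : ℝ) {w : α → ℝ} (hw : ∑ a, w a = 1) :
    ∑ a, blanketWeight γ w a = 1 := by
  have h := sum_blanketWeight_mul γ w fun _ => 1
  simp only [mul_one, Finset.sum_const, Finset.card_univ, nsmul_eq_mul, hw] at h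
  rw [inv_mul_cancel₀ (by simp)] at h
  rw [h]
  ring

end BlanketWeight

/-! ### Hiding one message from symmetric tests -/

section Blanket

variable {ι α : Type*} [Fintype ι] [DecidableEq ι] [Fintype α] [DecidableEq α]

/-- If the users in `T` send uniformly random messages, then a symmetric test can hardly notice
which message one of them has sent. -/
theorem sum_test_le_of_uniform {q : ι → α → ℝ} (hq0 : ∀ j a, 0 ≤ q j a)
    (hq : ∀ j, ∑ a, q j a = 1) {T : Finset ι}
    (hT : ∀ j ∈ T, ∀ a, q j a = (Fintype.card α : ℝ)⁻¹)
    {f : (ι → α) → ℝ} (hf0 : ∀ z, 0 ≤ f z) (hf1 : ∀ z, f z ≤ 1)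
    (hf : ∀ z (σ : Equiv.Perm ι), f (z ∘ σ) = f z) {i : ι} (hi : i ∈ T) (a b : α)
    {δ : ℝ} (hδ : 0 < δ) :
    ∑ z : ι → α, f z * ((Fintype.card α : ℝ) *
        ((if z i = a then 1 else 0) - (if z i = b then 1 else 0))) * ∏ j, q j (z j)
      ≤ δ / 2 + Fintype.card α / (δ * T.card) := by
  set B : ℝ := (Fintype.card α : ℝ) with hB
  have hB0 : 0 < B := by
    have : 0 < Fintype.card α := Fintype.card_pos_iff.2 ⟨a⟩
    rw [hB]
    exact_mod_cast this
  have hT0 : (0 : ℝ) < T.card := by exact_mod_cast Finset.card_pos.2 ⟨i, hi⟩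
  set D : α → ℝ := fun c => (if c = a then 1 else 0) - (if c = b then 1 else 0) with hD
  set φ : ι → α → ℝ := fun j c => if j ∈ T then D c else 0 with hφ
  have hDsum : ∑ c, D c = 0 := by simp [hD]
  have hDsq : ∑ c, D c ^ 2 ≤ 2 := by
    calc ∑ c, D c ^ 2 ≤ ∑ c, ((if c = a then 1 else 0) + (if c = b then (1 : ℝ) else 0)) := by
          refine Finset.sum_le_sum fun c _ => ?_
          simp only [hD]
          split_ifs <;> norm_num
      _ = 2 := by
          rw [Finset.sum_add_distrib]; simp; norm_num
  have hswap : ∀ j ∈ T, ∑ z : ι → α, f z * (B * D (z j)) * ∏ j, q j (z j)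
      = ∑ z : ι → α, f z * (B * D (z i)) * ∏ j, q j (z j) := by
    intro j hj
    have hqq : q i = q j := by
      ext c
      rw [hT i hi, hT j hj]
    rw [← sum_comp_swap_mul_prod hqq fun z => f z * (B * D (z i))]
    refine Finset.sum_congr rfl fun z _ => ?_
    rw [hf]
    simp
  -- The users in `T` are exchangeable and `f` is symmetric, so `D (z i)` may be replaced by its
  -- average over `T`, whose variance is smaller by the factor `T.card`.
  have hY : ∑ z : ι → α, f z * (B * D (z i)) * ∏ j, q j (z j)
      = ∑ z : ι → α, f z * (B / T.card * ∑ j, φ j (z j)) * ∏ j, q j (z j) := by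
    have h1 : ∀ z : ι → α, f z * (B / T.card * ∑ j, φ j (z j)) * ∏ j, q j (z j)
        = (T.card : ℝ)⁻¹ * ∑ j ∈ T, f z * (B * D (z j)) * ∏ j, q j (z j) := by
      intro z
      simp only [hφ, Finset.sum_ite_mem, Finset.univ_inter]
      rw [← Finset.sum_mul, ← Finset.mul_sum, ← Finset.mul_sum]
      ring
    simp_rw [h1]
    rw [← Finset.mul_sum, Finset.sum_comm, Finset.sum_congr rfl hswap, Finset.sum_const,
      nsmul_eq_mul, ← mul_assoc, inv_mul_cancel₀ hT0.ne', one_mul]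
  change ∑ z : ι → α, f z * (B * D (z i)) * ∏ j, q j (z j) ≤ _
  rw [hY]
  have hpt : ∀ z : ι → α, f z * (B / T.card * ∑ j, φ j (z j)) * ∏ j, q j (z j)
      ≤ δ / 2 * ∏ j, q j (z j)
        + (B / T.card) ^ 2 / (2 * δ) * ((∏ j, q j (z j)) * (∑ j, φ j (z j)) ^ 2) := by
    intro z
    have hp : 0 ≤ ∏ j, q j (z j) := Finset.prod_nonneg fun j _ => hq0 _ _
    set y : ℝ := B / T.card * ∑ j, φ j (z j) with hy
    -- AM-GM in place of Cauchy-Schwarz: only the second moment of `y` remains to be bounded.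
    have h2 : f z * y ≤ δ / 2 + y ^ 2 / (2 * δ) := by
      have h3 : f z * y ≤ |y| := by
        calc f z * y ≤ f z * |y| := mul_le_mul_of_nonneg_left (le_abs_self y) (hf0 z)
          _ ≤ 1 * |y| := mul_le_mul_of_nonneg_right (hf1 z) (abs_nonneg y)
          _ = |y| := one_mul _
      have h4 : δ / 2 + y ^ 2 / (2 * δ) - |y| = (δ - |y|) ^ 2 / (2 * δ) := by
        rw [← sq_abs y]
        field_simp
        ring
      have h5 : 0 ≤ (δ - |y|) ^ 2 / (2 * δ) := by positivity
      linarith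
    calc f z * y * ∏ j, q j (z j) ≤ (δ / 2 + y ^ 2 / (2 * δ)) * ∏ j, q j (z j) :=
          mul_le_mul_of_nonneg_right h2 hp
      _ = _ := by rw [hy]; ring
  refine (Finset.sum_le_sum fun z _ => hpt z).trans ?_
  rw [Finset.sum_add_distrib, ← Finset.mul_sum, ← Finset.mul_sum, sum_prod_eq_one hq,
    sum_prod_mul_sum_sq hq, mul_one]
  · have h6 : ∑ j, ∑ c, q j c * φ j c ^ 2 ≤ T.card * (B⁻¹ * 2) := by
      calc ∑ j, ∑ c, q j c * φ j c ^ 2 = ∑ j ∈ T, B⁻¹ * ∑ c, D c ^ 2 := by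
            rw [← Finset.sum_subset (Finset.subset_univ T)]
            · refine Finset.sum_congr rfl fun j hj => ?_
              rw [Finset.mul_sum]
              exact Finset.sum_congr rfl fun c _ => by simp [hφ, hj, hT j hj]
            · intro j _ hj
              simp [hφ, hj]
        _ = T.card * (B⁻¹ * ∑ c, D c ^ 2) := by rw [Finset.sum_const, nsmul_eq_mul]
        _ ≤ _ := by gcongr
    have h7 : (B / T.card) ^ 2 / (2 * δ) * (T.card * (B⁻¹ * 2)) = B / (δ * T.card) := by
      field_simp
    have h8 := mul_le_mul_of_nonneg_left h6 (by positivity : 0 ≤ (B / T.card) ^ 2 / (2 * δ))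
    linarith
  · intro j
    by_cases hj : j ∈ T
    · simp only [hφ, hj, if_true, hT j hj]
      rw [← Finset.mul_sum, hDsum, mul_zero]
    · simp [hφ, hj]

/-- A symmetric test can hardly notice which message user `i` has sent, if the other users send
uniformly random messages with probability `γ` each. -/
theorem sum_test_sub_le {γ δ : ℝ} (hγ0 : 0 ≤ γ) (hγ1 : γ ≤ 1) (hδ : 0 < δ)
    (hn : 2 * (Fintype.card α : ℝ) ≤ Fintype.card ι * γ * δ ^ 2)
    {w : ι → α → ℝ} (hw0 : ∀ j a, 0 ≤ w j a) (hw : ∀ j, ∑ a, w j a = 1)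
    {f : (ι → α) → ℝ} (hf0 : ∀ z, 0 ≤ f z) (hf1 : ∀ z, f z ≤ 1)
    (hf : ∀ z (σ : Equiv.Perm ι), f (z ∘ σ) = f z) (i : ι) (a b : α) :
    ∑ z : ι → α, f z * ((if z i = a then 1 else 0) - (if z i = b then 1 else 0)) *
        ∏ j ∈ Finset.univ.erase i, blanketWeight γ (w j) (z j) ≤ δ := by
  have : Nonempty α := ⟨a⟩
  set B : ℝ := (Fintype.card α : ℝ) with hB
  have hB0 : 0 < B := by
    have : 0 < Fintype.card α := Fintype.card_pos
    rw [hB]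
    exact_mod_cast this
  set E : Finset ι := Finset.univ.erase i with hE
  have hEc : (Fintype.card ι : ℝ) = E.card + 1 := by
    have := Finset.card_erase_add_one (Finset.mem_univ i)
    rw [Finset.card_univ] at this
    exact_mod_cast this.symm
  -- Expand over the set `S` of users who send blanket messages. User `i` does not occur in the
  -- product; it receives a fictitious uniform law, compensated by the factor `B`, and so joins the
  -- blanket.
  have hexp : ∀ z : ι → α, ∏ j ∈ E, blanketWeight γ (w j) (z j)
      = ∑ S ∈ E.powerset, γ ^ S.card * (1 - γ) ^ (E.card - S.card) *
        (B * ∏ j, if j ∈ insert i S then B⁻¹ else w j (z j)) := by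
    intro z
    simp only [blanketWeight, ← hB]
    rw [Finset.prod_add]
    refine Finset.sum_congr rfl fun S hS => ?_
    have hS' := Finset.mem_powerset.1 hS
    have hiS : i ∉ S := fun h => by simpa [hE] using hS' h
    have hu : (Finset.univ : Finset ι) = insert i E := by simp [hE]
    have h1 : ∏ j, (if j ∈ insert i S then B⁻¹ else w j (z j))
        = B⁻¹ * ((∏ j ∈ S, B⁻¹) * ∏ j ∈ E \ S, w j (z j)) := by
      rw [hu, Finset.prod_insert (by simp [hE]), if_pos (Finset.mem_insert_self _ _),
        ← Finset.prod_sdiff hS', mul_comm (∏ j ∈ E \ S, _)]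
      congr 2
      · exact Finset.prod_congr rfl fun j hj => if_pos (Finset.mem_insert_of_mem hj)
      · refine Finset.prod_congr rfl fun j hj => if_neg ?_
        have hj' := Finset.mem_sdiff.1 hj
        rw [Finset.mem_insert]
        rintro (rfl | h)
        · simpa [hE] using hj'.1
        · exact hj'.2 h
    rw [h1, Finset.prod_mul_distrib, Finset.prod_mul_distrib, Finset.prod_const,
      Finset.prod_const (1 - γ), Finset.card_sdiff_of_subset hS', mul_inv_cancel_left₀ hB0.ne']
    ring
  have hS : ∀ S ∈ E.powerset, ∑ z : ι → α, f z * (B *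
        ((if z i = a then 1 else 0) - (if z i = b then 1 else 0))) *
          ∏ j, (if j ∈ insert i S then B⁻¹ else w j (z j))
      ≤ δ / 2 + B / δ * ((S.card : ℝ) + 1)⁻¹ := by
    intro S hS
    have hiS : i ∉ S := fun h => by simpa [hE] using Finset.mem_powerset.1 hS h
    have h2 := sum_test_le_of_uniform (q := fun j c => if j ∈ insert i S then B⁻¹ else w j c)
      (T := insert i S) ?_ ?_ ?_ hf0 hf1 hf (Finset.mem_insert_self i S) a b hδ
    · refine h2.trans (le_of_eq ?_)
      rw [Finset.card_insert_of_notMem hiS]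
      push_cast
      rw [← hB]
      field_simp
    · intro j c
      split_ifs
      · positivity
      · exact hw0 _ _
    · intro j
      by_cases hj : j ∈ insert i S
      · simp only [hj, if_true, Finset.sum_const, Finset.card_univ, nsmul_eq_mul, ← hB]
        exact mul_inv_cancel₀ hB0.ne'
      · simp only [hj, if_false, hw]
    · intro j hj c
      simp only [hj, if_true, hB]
  have h1γ : 0 ≤ 1 - γ := by linarith
  calc _ = ∑ S ∈ E.powerset, γ ^ S.card * (1 - γ) ^ (E.card - S.card) *
        ∑ z : ι → α, f z * (B *
          ((if z i = a then 1 else 0) - (if z i = b then 1 else 0))) *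
            ∏ j, (if j ∈ insert i S then B⁻¹ else w j (z j)) := by
        simp_rw [hexp, Finset.mul_sum]
        rw [Finset.sum_comm]
        exact Finset.sum_congr rfl fun S _ => Finset.sum_congr rfl fun z _ => by ring
    _ ≤ ∑ S ∈ E.powerset, γ ^ S.card * (1 - γ) ^ (E.card - S.card) *
          (δ / 2 + B / δ * ((S.card : ℝ) + 1)⁻¹) :=
        Finset.sum_le_sum fun S h => mul_le_mul_of_nonneg_left (hS S h) (by positivity)
    _ = δ / 2 + B / δ * ∑ S ∈ E.powerset, γ ^ S.card * (1 - γ) ^ (E.card - S.card) *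
          ((S.card : ℝ) + 1)⁻¹ := by
        simp_rw [mul_add]
        rw [Finset.sum_add_distrib, ← Finset.sum_mul, sum_powerset_pow_mul_pow, one_mul,
          Finset.mul_sum]
        congr 1
        exact Finset.sum_congr rfl fun S _ => by ring
    _ ≤ δ := by
        set X := ∑ S ∈ E.powerset, γ ^ S.card * (1 - γ) ^ (E.card - S.card) *
          ((S.card : ℝ) + 1)⁻¹ with hX
        have hX1 : (E.card + 1) * γ * X ≤ 1 := sum_powerset_div_card_le hγ1
        have hX0 : 0 ≤ X := Finset.sum_nonneg fun S _ => by positivity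
        have h3 : 2 * B * X ≤ δ ^ 2 := by
          rw [hEc] at hn
          calc 2 * B * X ≤ (E.card + 1) * γ * δ ^ 2 * X := mul_le_mul_of_nonneg_right hn hX0
            _ = δ ^ 2 * ((E.card + 1) * γ * X) := by ring
            _ ≤ δ ^ 2 * 1 := by gcongr
            _ = δ ^ 2 := mul_one _
        have h4 : B / δ * X ≤ δ / 2 := by
          rw [div_mul_eq_mul_div, div_le_iff₀ hδ]
          nlinarith
        linarith

/-- Two product distributions of blanketed messages that differ in the message of one user are
hardly distinguished by a symmetric test. -/
theorem sum_test_le_add {γ δ : ℝ} (hγ0 : 0 ≤ γ) (hγ1 : γ ≤ 1) (hδ : 0 < δ)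
    (hn : 2 * (Fintype.card α : ℝ) ≤ Fintype.card ι * γ * δ ^ 2) [Nonempty α]
    {w w' : ι → α → ℝ} (hw0 : ∀ j a, 0 ≤ w j a) (hw : ∀ j, ∑ a, w j a = 1)
    (hw0' : ∀ j a, 0 ≤ w' j a) (hw' : ∀ j, ∑ a, w' j a = 1) {i : ι}
    (hww' : ∀ j, j ≠ i → w j = w' j)
    {f : (ι → α) → ℝ} (hf0 : ∀ z, 0 ≤ f z) (hf1 : ∀ z, f z ≤ 1)
    (hf : ∀ z (σ : Equiv.Perm ι), f (z ∘ σ) = f z) :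
    ∑ z : ι → α, (∏ j, blanketWeight γ (w j) (z j)) * f z
      ≤ ∑ z : ι → α, (∏ j, blanketWeight γ (w' j) (z j)) * f z + δ := by
  -- `g a` is the acceptance probability when user `i` sends `a`. Both sides are averages of `g`,
  -- whose oscillation is at most `δ`.
  set g : α → ℝ := fun a => ∑ z : ι → α, f z * (if z i = a then 1 else 0) *
        ∏ j ∈ Finset.univ.erase i, blanketWeight γ (w j) (z j) with hg
  have hgg : ∀ a b, g a - g b ≤ δ := by
    intro a b
    have h := sum_test_sub_le hγ0 hγ1 hδ hn hw0 hw hf0 hf1 hf i a b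
    simpa only [hg, mul_sub, sub_mul, Finset.sum_sub_distrib] using h
  have key : ∀ u : ι → α → ℝ, (∀ j, j ≠ i → w j = u j) →
      ∑ z : ι → α, (∏ j, blanketWeight γ (u j) (z j)) * f z
        = ∑ a, blanketWeight γ (u i) a * g a := by
    intro u hu
    simp only [hg, Finset.mul_sum]
    rw [Finset.sum_comm]
    refine Finset.sum_congr rfl fun z _ => ?_
    rw [Finset.sum_eq_single (z i)]
    · rw [if_pos rfl, ← Finset.mul_prod_erase _ _ (Finset.mem_univ i)]
      have : ∏ j ∈ Finset.univ.erase i, blanketWeight γ (u j) (z j)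
          = ∏ j ∈ Finset.univ.erase i, blanketWeight γ (w j) (z j) :=
        Finset.prod_congr rfl fun j hj => by rw [hu j (Finset.ne_of_mem_erase hj)]
      rw [this]
      ring
    · intro a _ ha
      simp [ha.symm]
    · simp
  rw [key w fun _ _ => rfl, key w' hww']
  have h1 := sum_blanketWeight γ (hw i)
  have h2 := sum_blanketWeight γ (hw' i)
  obtain ⟨b, hb⟩ := Finite.exists_min g
  calc ∑ a, blanketWeight γ (w i) a * g a
      ≤ ∑ a, blanketWeight γ (w i) a * (g b + δ) :=
        Finset.sum_le_sum fun a _ => mul_le_mul_of_nonneg_left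
          (by linarith [hgg a b]) (blanketWeight_nonneg hγ0 hγ1 (hw0 _ _))
    _ = ∑ a, blanketWeight γ (w' i) a * g b + δ := by
        rw [← Finset.sum_mul, ← Finset.sum_mul, h1, h2]; ring
    _ ≤ _ := by
        gcongr with a
        · exact blanketWeight_nonneg hγ0 hγ1 (hw0' _ _)
        · exact hb a

end Blanket

/-! ### The shuffler -/

theorem lintegral_shuffle {n : ℕ} {Z : Type*} [MeasurableSpace Z] (μ : Measure (Fin n → Z))
    {h : (Fin n → Z) → ENNReal} (hh : Measurable h) :
    ∫⁻ z, h z ∂(shuffle μ)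
      = ∫⁻ z, (n.factorial : ENNReal)⁻¹ * ∑ σ : Equiv.Perm (Fin n), h (z ∘ σ) ∂μ := by
  have hσ : ∀ σ : Equiv.Perm (Fin n), Measurable fun z : Fin n → Z => fun i => z (σ i) :=
    fun σ => measurable_pi_lambda _ fun i => measurable_pi_apply _
  have hm : ∀ σ : Equiv.Perm (Fin n), Measurable fun z : Fin n → Z => h (z ∘ σ) :=
    fun σ => hh.comp (hσ σ)
  rw [shuffle, lintegral_smul_measure, lintegral_finsetSum_measure,
    lintegral_const_mul _ (Finset.measurable_sum _ fun σ _ => hm σ),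
    lintegral_finsetSum _ fun σ _ => hm σ, smul_eq_mul]
  congr 1
  exact Finset.sum_congr rfl fun σ _ => lintegral_map hh (hσ σ)

/-- The average of `H` over all permutations of its arguments. -/
noncomputable def permAverage {n : ℕ} {Z : Type*} (H : (Fin n → Z) → ℝ) (z : Fin n → Z) : ℝ :=
  (n.factorial : ℝ)⁻¹ * ∑ σ : Equiv.Perm (Fin n), H (z ∘ σ)

section PermAverage

variable {n : ℕ} {Z : Type*} {H : (Fin n → Z) → ℝ}

theorem permAverage_comp (z : Fin n → Z) (τ : Equiv.Perm (Fin n)) :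
    permAverage H (z ∘ τ) = permAverage H z := by
  unfold permAverage
  congr 1
  rw [← Equiv.sum_comp (Equiv.mulLeft τ) fun σ => H (z ∘ σ)]
  rfl

theorem permAverage_nonneg (h : ∀ z, 0 ≤ H z) (z : Fin n → Z) : 0 ≤ permAverage H z :=
  mul_nonneg (by positivity) (Finset.sum_nonneg fun _ _ => h _)

theorem permAverage_le_one (h : ∀ z, H z ≤ 1) (z : Fin n → Z) : permAverage H z ≤ 1 := by
  have h1 : ∑ σ : Equiv.Perm (Fin n), H (z ∘ σ) ≤ n.factorial := by
    calc ∑ σ : Equiv.Perm (Fin n), H (z ∘ σ) ≤ ∑ _σ : Equiv.Perm (Fin n), (1 : ℝ) :=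
          Finset.sum_le_sum fun _ _ => h _
      _ = n.factorial := by simp [Fintype.card_perm]
  unfold permAverage
  rw [inv_mul_le_iff₀ (by positivity), mul_one]
  exact h1

theorem permAverage_eq_self (h : ∀ z (σ : Equiv.Perm (Fin n)), H (z ∘ σ) = H z)
    (z : Fin n → Z) : permAverage H z = H z := by
  unfold permAverage
  simp only [h, Finset.sum_const, Finset.card_univ, Fintype.card_perm, Fintype.card_fin,
    nsmul_eq_mul]
  exact inv_mul_cancel_left₀ (by positivity) _

end PermAverage

/-! ### The blanketed protocol -/

/-! ### Randomizers with finitely many messages -/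

section FiniteKernel

variable {X α : Type*} [MeasurableSpace X] [Fintype α] [MeasurableSpace α]

/-- The kernel that sends `x` to the distribution with weights `q x` on a finite type. -/
noncomputable def finiteKernel (q : X → α → ℝ) (hq : ∀ a, Measurable fun x => q x a) :
    Kernel X α where
  toFun x := ∑ a, ENNReal.ofReal (q x a) • Measure.dirac a
  measurable' := by
    refine Measure.measurable_of_measurable_coe _ fun s _ => ?_
    simp only [Measure.coe_finsetSum, Finset.sum_apply, Measure.smul_apply, smul_eq_mul]
    exact Finset.measurable_sum _ fun a _ => (hq a).ennreal_ofReal.mul_const _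

theorem finiteKernel_singleton [MeasurableSingletonClass α] {q : X → α → ℝ}
    (hq : ∀ a, Measurable fun x => q x a) (x : X) (a : α) :
    finiteKernel q hq x {a} = ENNReal.ofReal (q x a) := by
  classical
  change (∑ b, ENNReal.ofReal (q x b) • Measure.dirac b : Measure α) {a} = _
  simp only [Measure.coe_finsetSum, Finset.sum_apply, Measure.smul_apply, smul_eq_mul]
  rw [Finset.sum_eq_single a]
  · simp
  · intro b _ hb
    simp [hb]
  · simp

theorem isMarkovKernel_finiteKernel {q : X → α → ℝ}
    (hq : ∀ a, Measurable fun x => q x a) (h0 : ∀ x a, 0 ≤ q x a) (h1 : ∀ x, ∑ a, q x a = 1) :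
    IsMarkovKernel (finiteKernel q hq) := by
  refine ⟨fun x => ⟨?_⟩⟩
  change (∑ b, ENNReal.ofReal (q x b) • Measure.dirac b : Measure α) Set.univ = _
  simp only [Measure.coe_finsetSum, Finset.sum_apply, Measure.smul_apply, smul_eq_mul,
    measure_univ, mul_one]
  rw [← ENNReal.ofReal_sum_of_nonneg fun a _ => h0 x a, h1, ENNReal.ofReal_one]

/-- The randomness of the shuffler is moved onto the integrand: what remains is a finite product law
and a symmetric function. -/
theorem lintegral_shuffle_pi_finiteKernel [MeasurableSingletonClass α] {q : X → α → ℝ}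
    (hq : ∀ a, Measurable fun x => q x a) (h0 : ∀ x a, 0 ≤ q x a) (h1 : ∀ x, ∑ a, q x a = 1)
    {n : ℕ} (v : Fin n → X) {H : (Fin n → α) → ℝ} (hH : ∀ z, 0 ≤ H z) :
    ∫⁻ z, ENNReal.ofReal (H z) ∂(shuffle (Measure.pi fun i => finiteKernel q hq (v i)))
      = ENNReal.ofReal (∑ z : Fin n → α, (∏ j, q (v j) (z j)) * permAverage H z) := by
  have := isMarkovKernel_finiteKernel hq h0 h1
  rw [lintegral_shuffle _ (measurable_of_finite _), lintegral_fintype,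
    ENNReal.ofReal_sum_of_nonneg fun z _ =>
      mul_nonneg (Finset.prod_nonneg fun j _ => h0 _ _) (permAverage_nonneg hH z)]
  refine Finset.sum_congr rfl fun z _ => ?_
  rw [ENNReal.ofReal_mul (Finset.prod_nonneg fun j _ => h0 _ _), mul_comm, Measure.pi_singleton,
    ENNReal.ofReal_prod_of_nonneg fun j _ => h0 _ _, permAverage,
    ENNReal.ofReal_mul (by positivity), ENNReal.ofReal_inv_of_pos (by positivity),
    ENNReal.ofReal_natCast, ENNReal.ofReal_sum_of_nonneg fun σ _ => hH _]
  simp only [finiteKernel_singleton]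

end FiniteKernel

/-- An unbiased randomized rounding of the vectors of the unit ball to the finite family of points
`p`: the vector `v` is rounded to `p a` with probability `w v a`. -/
structure Rounding (d : ℕ) (α : Type*) [Fintype α] where
  /-- The points. -/
  p : α → EuclideanSpace ℝ (Fin d)
  /-- The probabilities. -/
  w : InputVec d → α → ℝ
  measurable_w : ∀ a, Measurable fun v => w v a
  nonneg : ∀ v a, 0 ≤ w v a
  sum_eq_one : ∀ v, ∑ a, w v a = 1
  unbiased : ∀ v c, ∑ a, w v a * p a c = v.1 c

namespace Rounding

/-! ### Bias and variance of one estimate -/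

section Estimate

variable {d : ℕ} {α : Type*} [Fintype α]

/-- The estimate of the vector of a user after a message `a`; the subtraction and the scaling undo
the bias of the blanket. -/
noncomputable def estimate (Q : Rounding d α) (γ : ℝ) (a : α) : EuclideanSpace ℝ (Fin d) :=
  (1 - γ)⁻¹ • (Q.p a - γ • ((Fintype.card α : ℝ)⁻¹ • ∑ b, Q.p b))

variable [Nonempty α] {Q : Rounding d α} {γ : ℝ}

theorem sum_blanketWeight_mul_estimate_sub (h2 : γ < 1) (v : InputVec d) (c : Fin d) :
    ∑ a, blanketWeight γ (Q.w v) a * (Q.estimate γ a - v.1) c = 0 := by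
  have hγ : 1 - γ ≠ 0 := by linarith
  have hu := Q.unbiased v c
  have hs := Q.sum_eq_one v
  have hb := sum_blanketWeight γ hs
  set m : ℝ := (Fintype.card α : ℝ)⁻¹ * ∑ b, Q.p b c with hm
  have he : ∀ a, (Q.estimate γ a - v.1) c = (1 - γ)⁻¹ * (Q.p a c - γ * m) - v.1 c := by
    intro a
    simp [estimate, hm]
  have h3 := sum_blanketWeight_mul γ (Q.w v) fun a => Q.p a c
  rw [hu, ← hm] at h3
  calc _ = (1 - γ)⁻¹ * ∑ a, blanketWeight γ (Q.w v) a * Q.p a c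
        - ((1 - γ)⁻¹ * (γ * m) + v.1 c) * ∑ a, blanketWeight γ (Q.w v) a := by
        rw [Finset.mul_sum, Finset.mul_sum, ← Finset.sum_sub_distrib]
        exact Finset.sum_congr rfl fun a _ => by rw [he]; ring
    _ = 0 := by
        rw [h3, hb]
        field_simp
        ring

/-- A rounded message costs `s²`, a blanket message `r²` with probability `γ`, and the debiasing
shift `(γr)² ≤ γr²`. Squaring `(1 - γ)⁻¹ ≤ 2` and `(x + y)² ≤ 2x² + 2y²` give the factor `8`,
doubled when the terms are merged. -/
theorem sum_blanketWeight_mul_norm_sq_le {r s : ℝ} (h0 : 0 ≤ γ) (h2 : γ ≤ 1 / 2)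
    (v : InputVec d) (hr : ∀ a, ‖Q.p a - v.1‖ ≤ r) (hs : ∀ a, Q.w v a ≠ 0 → ‖Q.p a - v.1‖ ≤ s) :
    ∑ a, blanketWeight γ (Q.w v) a * ‖Q.estimate γ a - v.1‖ ^ 2 ≤ 16 * (s ^ 2 + γ * r ^ 2) := by
  have hγ : 1 - γ ≠ 0 := by linarith
  have hB0 : (0 : ℝ) < Fintype.card α := by exact_mod_cast Fintype.card_pos (α := α)
  set m : EuclideanSpace ℝ (Fin d) := (Fintype.card α : ℝ)⁻¹ • ∑ b, Q.p b with hm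
  have hmv : ‖v.1 - m‖ ≤ r := by
    have h3 : v.1 - m = (Fintype.card α : ℝ)⁻¹ • ∑ b, (v.1 - Q.p b) := by
      rw [Finset.sum_sub_distrib, smul_sub, Finset.sum_const, Finset.card_univ,
        ← Nat.cast_smul_eq_nsmul ℝ, smul_smul, inv_mul_cancel₀ hB0.ne', one_smul]
    rw [h3, norm_smul, Real.norm_of_nonneg (by positivity), inv_mul_le_iff₀ hB0]
    calc ‖∑ b, (v.1 - Q.p b)‖ ≤ ∑ b, ‖v.1 - Q.p b‖ := norm_sum_le _ _
      _ ≤ ∑ _b : α, r := Finset.sum_le_sum fun b _ => by rw [norm_sub_rev]; exact hr b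
      _ = _ := by simp
  have hinv : (1 - γ)⁻¹ ≤ 2 := by
    rw [inv_le_comm₀ (by linarith) (by norm_num)]
    linarith
  have hinv0 : 0 ≤ (1 - γ)⁻¹ := inv_nonneg.2 (by linarith)
  have hpt : ∀ a, ‖Q.estimate γ a - v.1‖ ^ 2 ≤ 8 * ‖Q.p a - v.1‖ ^ 2 + 8 * (γ * r) ^ 2 := by
    intro a
    have h4 : Q.estimate γ a - v.1 = (1 - γ)⁻¹ • ((Q.p a - v.1) + γ • (v.1 - m)) := by
      have h5 : v.1 = (1 - γ)⁻¹ • ((1 - γ) • v.1) := by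
        rw [smul_smul, inv_mul_cancel₀ hγ, one_smul]
      rw [estimate, ← hm]
      nth_rewrite 1 [h5]
      rw [← smul_sub]
      congr 1
      module
    have h6 : ‖Q.estimate γ a - v.1‖ ≤ 2 * (‖Q.p a - v.1‖ + γ * r) := by
      rw [h4, norm_smul, Real.norm_of_nonneg hinv0]
      refine mul_le_mul hinv ?_ (norm_nonneg _) (by norm_num)
      refine (norm_add_le _ _).trans ?_
      rw [norm_smul, Real.norm_of_nonneg h0]
      gcongr
    calc ‖Q.estimate γ a - v.1‖ ^ 2 ≤ (2 * (‖Q.p a - v.1‖ + γ * r)) ^ 2 := by gcongr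
      _ ≤ _ := by nlinarith [sq_nonneg (‖Q.p a - v.1‖ - γ * r)]
  have hE : ∑ a, blanketWeight γ (Q.w v) a * ‖Q.p a - v.1‖ ^ 2 ≤ γ * r ^ 2 + s ^ 2 := by
    rw [sum_blanketWeight_mul]
    have h7 : (Fintype.card α : ℝ)⁻¹ * ∑ a, ‖Q.p a - v.1‖ ^ 2 ≤ r ^ 2 := by
      rw [inv_mul_le_iff₀ hB0]
      calc ∑ a, ‖Q.p a - v.1‖ ^ 2 ≤ ∑ _a : α, r ^ 2 :=
            Finset.sum_le_sum fun a _ => pow_le_pow_left₀ (norm_nonneg _) (hr a) 2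
        _ = _ := by simp
    have h8 : ∑ a, Q.w v a * ‖Q.p a - v.1‖ ^ 2 ≤ s ^ 2 := by
      calc ∑ a, Q.w v a * ‖Q.p a - v.1‖ ^ 2 ≤ ∑ a, Q.w v a * s ^ 2 := by
            refine Finset.sum_le_sum fun a _ => ?_
            by_cases ha : Q.w v a = 0
            · simp [ha]
            · exact mul_le_mul_of_nonneg_left
                (pow_le_pow_left₀ (norm_nonneg _) (hs a ha) 2) (Q.nonneg v a)
        _ = s ^ 2 := by rw [← Finset.sum_mul, Q.sum_eq_one, one_mul]
    have h9 := mul_le_mul_of_nonneg_left h7 h0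
    have h10 := mul_le_mul_of_nonneg_left h8 (by linarith : 0 ≤ 1 - γ)
    nlinarith [sq_nonneg s]
  calc _ ≤ ∑ a, blanketWeight γ (Q.w v) a * (8 * ‖Q.p a - v.1‖ ^ 2 + 8 * (γ * r) ^ 2) :=
        Finset.sum_le_sum fun a _ => mul_le_mul_of_nonneg_left (hpt a)
          (blanketWeight_nonneg h0 (by linarith) (Q.nonneg v a))
    _ = 8 * ∑ a, blanketWeight γ (Q.w v) a * ‖Q.p a - v.1‖ ^ 2 + 8 * (γ * r) ^ 2 := by
        simp_rw [mul_add]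
        rw [Finset.sum_add_distrib, ← Finset.sum_mul, sum_blanketWeight γ (Q.sum_eq_one v),
          one_mul, Finset.mul_sum]
        congr 1
        exact Finset.sum_congr rfl fun a _ => by ring
    _ ≤ _ := by
        have h11 : γ ^ 2 * r ^ 2 ≤ γ * r ^ 2 :=
          mul_le_mul_of_nonneg_right (by nlinarith) (sq_nonneg r)
        nlinarith [sq_nonneg s]

end Estimate

variable {d : ℕ} {α : Type} [Fintype α] [Nonempty α] [MeasurableSpace α]
  [MeasurableSingletonClass α] (Q : Rounding d α)

/-- Every user sends a uniformly random message with probability `γ`, and otherwise rounds its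
vector. -/
noncomputable def protocol (n : ℕ) (γ : ℝ) (h0 : 0 ≤ γ) (h1 : γ ≤ 1) :
    SingleMessageProtocol d n where
  Message := α
  randomizer := finiteKernel (fun v => blanketWeight γ (Q.w v))
    fun a => ((Q.measurable_w a).const_mul _).const_add _
  isMarkovKernel := isMarkovKernel_finiteKernel _
    (fun v a => blanketWeight_nonneg h0 h1 (Q.nonneg v a))
    fun v => sum_blanketWeight γ (Q.sum_eq_one v)
  aggregator z := ∑ j, Q.estimate γ (z j)
  measurable_aggregator := measurable_of_finite _

variable {n : ℕ} {γ : ℝ} (h0 : 0 ≤ γ) (h1 : γ ≤ 1)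

theorem lintegral_shuffledMessages (v : Fin n → InputVec d) {H : (Fin n → α) → ℝ}
    (hH : ∀ z, 0 ≤ H z) :
    ∫⁻ z : Fin n → α, ENNReal.ofReal (H z) ∂((Q.protocol n γ h0 h1).shuffledMessages v :)
      = ENNReal.ofReal
        (∑ z : Fin n → α, (∏ j, blanketWeight γ (Q.w (v j)) (z j)) * permAverage H z) :=
  lintegral_shuffle_pi_finiteKernel
    (fun a => ((Q.measurable_w a).const_mul _).const_add _)
    (fun v a => blanketWeight_nonneg h0 h1 (Q.nonneg v a))
    (fun v => sum_blanketWeight γ (Q.sum_eq_one v)) v hH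

theorem isShuffleDP_protocol {ε δ : ℝ} (hε : 0 ≤ ε) (hδ : 0 < δ)
    (hn : 2 * (Fintype.card α : ℝ) ≤ n * γ * δ ^ 2) :
    (Q.protocol n γ h0 h1).IsShuffleDP ε δ := by
  classical
  rintro x y ⟨i, hi⟩ U hU
  set H : (Fin n → α) → ℝ := fun z => if z ∈ U then 1 else 0 with hH
  have hH0 : ∀ z, 0 ≤ H z := fun z => by simp only [hH]; split_ifs <;> norm_num
  have hH1 : ∀ z, H z ≤ 1 := fun z => by simp only [hH]; split_ifs <;> norm_num
  have hU' : ∀ v, (Q.protocol n γ h0 h1).shuffledMessages v U = ENNReal.ofReal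
        (∑ z : Fin n → α, (∏ j, blanketWeight γ (Q.w (v j)) (z j)) * permAverage H z) := by
    intro v
    rw [← Q.lintegral_shuffledMessages h0 h1 v hH0, ← lintegral_indicator_one hU]
    refine lintegral_congr fun z => ?_
    change _ = ENNReal.ofReal (if z ∈ U then 1 else 0)
    by_cases hz : z ∈ U <;> simp [hz]
  have hS0 : 0 ≤ ∑ z : Fin n → α,
      (∏ j, blanketWeight γ (Q.w (y j)) (z j)) * permAverage H z :=
    Finset.sum_nonneg fun z _ => mul_nonneg
      (Finset.prod_nonneg fun j _ => blanketWeight_nonneg h0 h1 (Q.nonneg _ _))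
      (permAverage_nonneg hH0 z)
  rw [hU', hU', ← ENNReal.ofReal_mul (Real.exp_nonneg _),
    ← ENNReal.ofReal_add (mul_nonneg (Real.exp_nonneg _) hS0) hδ.le]
  refine ENNReal.ofReal_le_ofReal ?_
  have h2 := sum_test_le_add h0 h1 hδ (by simpa using hn)
    (w := fun j => Q.w (x j)) (w' := fun j => Q.w (y j)) (i := i)
    (fun _ _ => Q.nonneg _ _) (fun _ => Q.sum_eq_one _)
    (fun _ _ => Q.nonneg _ _) (fun _ => Q.sum_eq_one _)
    (fun j hj => by rw [hi j hj]) (permAverage_nonneg hH0) (permAverage_le_one hH1)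
    permAverage_comp
  -- The bound so far is the case `ε = 0`; the factor `exp ε ≥ 1` only weakens it.
  have h3 := mul_le_mul_of_nonneg_right (Real.one_le_exp hε) hS0
  linarith

variable {Q}

theorem mse_protocol_le {r s : ℝ} (h0 : 0 ≤ γ) (h2 : γ ≤ 1 / 2)
    (hr : ∀ (v : InputVec d) a, ‖Q.p a - v.1‖ ≤ r)
    (hs : ∀ (v : InputVec d) a, Q.w v a ≠ 0 → ‖Q.p a - v.1‖ ≤ s) :
    (Q.protocol n γ h0 (h2.trans (by norm_num))).mse
      ≤ ENNReal.ofReal (n * (16 * (s ^ 2 + γ * r ^ 2))) := by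
  refine iSup_le fun v => ?_
  set H : (Fin n → α) → ℝ := fun z => ‖∑ j, (Q.estimate γ (z j) - (v j).1)‖ ^ 2 with hH
  have hsymm : ∀ z (σ : Equiv.Perm (Fin n)), H (z ∘ σ) = H z := by
    intro z σ
    simp only [hH, Finset.sum_sub_distrib]
    congr 3
    exact Equiv.sum_comp σ fun j => Q.estimate γ (z j)
  have h3 := Q.lintegral_shuffledMessages h0 (h2.trans (by norm_num)) v
    (H := H) fun z => sq_nonneg _
  have h4 : ∀ z : Fin n → α,
      ‖(Q.protocol n γ h0 (h2.trans (by norm_num))).aggregator z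
        - ∑ i, (v i : EuclideanSpace ℝ (Fin d))‖ₑ ^ 2 = ENNReal.ofReal (H z) := by
    intro z
    simp only [hH, Finset.sum_sub_distrib]
    rw [ENNReal.ofReal_pow (norm_nonneg _), ofReal_norm]
    rfl
  refine ((lintegral_congr h4).trans h3).trans_le ?_
  refine ENNReal.ofReal_le_ofReal ?_
  have hq : ∀ j, ∑ a, blanketWeight γ (Q.w (v j)) a = 1 :=
    fun j => sum_blanketWeight γ (Q.sum_eq_one _)
  calc ∑ z : Fin n → α, (∏ j, blanketWeight γ (Q.w (v j)) (z j)) * permAverage H z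
      = ∑ c, ∑ z : Fin n → α, (∏ j, blanketWeight γ (Q.w (v j)) (z j)) *
          (∑ j, (Q.estimate γ (z j) - (v j).1) c) ^ 2 := by
        rw [Finset.sum_comm]
        refine Finset.sum_congr rfl fun z _ => ?_
        rw [permAverage_eq_self hsymm, ← Finset.mul_sum, hH]
        dsimp only
        rw [EuclideanSpace.real_norm_sq_eq]
        simp
    -- In each coordinate the users' errors are independent and centered, so the cross terms vanish.
    _ = ∑ c, ∑ j, ∑ a, blanketWeight γ (Q.w (v j)) a *
          (Q.estimate γ a - (v j).1) c ^ 2 :=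
        Finset.sum_congr rfl fun c _ => sum_prod_mul_sum_sq
          (q := fun j => blanketWeight γ (Q.w (v j)))
          (φ := fun j a => (Q.estimate γ a - (v j).1) c) hq
          fun j => sum_blanketWeight_mul_estimate_sub (by linarith) (v j) c
    _ = ∑ j, ∑ a, blanketWeight γ (Q.w (v j)) a * ‖Q.estimate γ a - (v j).1‖ ^ 2 := by
        rw [Finset.sum_comm]
        refine Finset.sum_congr rfl fun j _ => ?_
        rw [Finset.sum_comm]
        refine Finset.sum_congr rfl fun a _ => ?_
        rw [← Finset.mul_sum, EuclideanSpace.real_norm_sq_eq]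
    _ ≤ ∑ _j : Fin n, 16 * (s ^ 2 + γ * r ^ 2) :=
        Finset.sum_le_sum fun j _ => sum_blanketWeight_mul_norm_sq_le h0 h2 (v j) (hr _) (hs _)
    _ = n * (16 * (s ^ 2 + γ * r ^ 2)) := by simp

end Rounding

/-! ### Rounding to the vertices of a cross-polytope -/

/-! ### Norm bounds for inputs -/

namespace InputVec

variable {d : ℕ}

theorem norm_le_one (v : InputVec d) : ‖v.1‖ ≤ 1 := mem_closedBall_zero_iff.1 v.2

theorem sum_sq_le_one (v : InputVec d) : ∑ i, v.1 i ^ 2 ≤ 1 := by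
  have h := v.norm_le_one
  rw [← EuclideanSpace.real_norm_sq_eq]
  nlinarith [norm_nonneg v.1]

theorem abs_apply_le_one (v : InputVec d) (i : Fin d) : |v.1 i| ≤ 1 := by
  rw [← sq_le_one_iff_abs_le_one]
  exact (Finset.single_le_sum (f := fun i => v.1 i ^ 2) (fun _ _ => sq_nonneg _)
    (Finset.mem_univ i)).trans v.sum_sq_le_one

theorem sum_abs_le_sqrt (v : InputVec d) : ∑ i, |v.1 i| ≤ √d := by
  refine Real.le_sqrt_of_sq_le (sq_sum_le_card_mul_sum_sq.trans ?_)
  have h := v.sum_sq_le_one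
  simp only [sq_abs, Finset.card_univ, Fintype.card_fin]
  exact mul_le_of_le_one_right (Nat.cast_nonneg d) h

theorem measurable_apply (i : Fin d) : Measurable fun v : InputVec d => v.1 i := by
  have : Continuous fun v : InputVec d => v.1 i := by fun_prop
  exact this.measurable

end InputVec

/-- The sign `±1` that a Boolean stands for. -/
def boolSign (s : Bool) : ℝ := if s then 1 else -1

theorem boolSign_true : boolSign true = 1 := rfl

theorem boolSign_false : boolSign false = -1 := rfl

/-- Rounding to the points `±√d e_i`. -/
noncomputable def crossRounding (d : ℕ) (hd : 0 < d) : Rounding d (Fin d × Bool) where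
  p a := EuclideanSpace.single a.1 (boolSign a.2 * √d)
  -- The first term alone has mean `v` and total mass `‖v‖₁ / √d ≤ 1`; the second spreads the
  -- missing mass evenly over the `2d` vertices, whose mean is zero.
  w v a := (|v.1 a.1| + boolSign a.2 * v.1 a.1) / (2 * √d)
    + (1 - (∑ i, |v.1 i|) / √d) / (2 * d)
  measurable_w a := by
    have h := fun i : Fin d => InputVec.measurable_apply i
    have h2 : Measurable fun v : InputVec d => ∑ i, |v.1 i| :=
      Finset.measurable_sum _ fun i _ => (h i).abs
    exact (((h a.1).abs.add ((h a.1).const_mul _)).div_const _).add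
      (((h2.div_const _).const_sub _).div_const _)
  nonneg v a := by
    have hd' : 0 < √(d : ℝ) := Real.sqrt_pos.2 (by exact_mod_cast hd)
    have h1 : 0 ≤ |v.1 a.1| + boolSign a.2 * v.1 a.1 := by
      unfold boolSign
      split_ifs
      · linarith [neg_abs_le (v.1 a.1)]
      · linarith [le_abs_self (v.1 a.1)]
    have h2 : 0 ≤ 1 - (∑ i, |v.1 i|) / √d := by
      rw [sub_nonneg, div_le_one hd']
      exact v.sum_abs_le_sqrt
    positivity
  sum_eq_one v := by
    have hd0 : (d : ℝ) ≠ 0 := by exact_mod_cast hd.ne'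
    have hd' : √(d : ℝ) ≠ 0 := by positivity
    set S := ∑ i, |v.1 i|
    simp only [Fintype.sum_prod_type, Fintype.sum_bool, boolSign_true, boolSign_false]
    have h : ∀ i : Fin d, (|v.1 i| + 1 * v.1 i) / (2 * √d) + (1 - S / √d) / (2 * d)
        + ((|v.1 i| + -1 * v.1 i) / (2 * √d) + (1 - S / √d) / (2 * d))
        = |v.1 i| / √d + (1 - S / √d) / d := by
      intro i
      field_simp
      ring
    rw [Finset.sum_congr rfl fun i _ => h i, Finset.sum_add_distrib, ← Finset.sum_div,
      Finset.sum_const, Finset.card_univ, Fintype.card_fin, nsmul_eq_mul,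
      mul_div_cancel₀ _ hd0]
    ring
  unbiased v c := by
    have hd' : √(d : ℝ) ≠ 0 := by
      have : (0 : ℝ) < d := by exact_mod_cast hd
      positivity
    rw [Fintype.sum_prod_type, Finset.sum_eq_single c]
    · simp [boolSign]
      field_simp
      ring
    · intro i _ hi
      simp [hi.symm]
    · simp

/-! ### Rounding to the points of a grid -/

/-- The weight of the `l`-th of the `m + 1` equidistant points of `[-1, 1]` in the rounding of
`x`. -/
noncomputable def hatWeight (m : ℕ) (x : ℝ) (l : ℕ) : ℝ := max 0 (1 - |m * (x + 1) / 2 - l|)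

/-- The `l`-th of the `m + 1` equidistant points of `[-1, 1]`. -/
noncomputable def gridPoint (m l : ℕ) : ℝ := -1 + 2 * l / m

/-- The tent functions at the integers reproduce constants and the identity. In the induction,
either `y ≤ m` and the new tent vanishes at `y`, or only the last two tents contribute. -/
theorem sum_hat (m : ℕ) {y : ℝ} (h0 : 0 ≤ y) (h1 : y ≤ m) :
    ∑ l ∈ Finset.range (m + 1), max 0 (1 - |y - l|) = 1 ∧
      ∑ l ∈ Finset.range (m + 1), max 0 (1 - |y - l|) * l = y := by
  induction m with
  | zero =>
    have : y = 0 := le_antisymm (by simpa using h1) h0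
    simp [this]
  | succ m ih =>
    rw [Finset.sum_range_succ, Finset.sum_range_succ _ (m + 1)]
    push_cast at h1 ⊢
    rcases le_or_gt y m with h | h
    · have h2 : max 0 (1 - |y - (m + 1)|) = 0 := by
        rw [max_eq_left]
        rw [abs_of_nonpos (by linarith)]
        linarith
      rw [h2, (ih h).1, (ih h).2]
      simp
    · rw [Finset.sum_range_succ, Finset.sum_range_succ _ m]
      have h2 : ∀ l ∈ Finset.range m, max 0 (1 - |y - l|) = 0 := by
        intro l hl
        have hl' : (l : ℝ) + 1 ≤ m := by exact_mod_cast Finset.mem_range.1 hl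
        rw [max_eq_left]
        rw [abs_of_nonneg (by linarith)]
        linarith
      rw [Finset.sum_eq_zero h2, Finset.sum_eq_zero fun l hl => by rw [h2 l hl, zero_mul],
        abs_of_nonneg (by linarith : 0 ≤ y - m), abs_of_nonpos (by linarith : y - (m + 1) ≤ 0),
        max_eq_right (by linarith), max_eq_right (by linarith)]
      constructor <;> ring

section Hat

variable {m : ℕ} {x : ℝ}

theorem sum_hatWeight (hx : |x| ≤ 1) : ∑ l : Fin (m + 1), hatWeight m x l = 1 := by
  have h := abs_le.1 hx
  rw [Fin.sum_univ_eq_sum_range fun l => hatWeight m x l]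
  refine (sum_hat m (y := m * (x + 1) / 2) ?_ ?_).1
  · have : 0 ≤ x + 1 := by linarith
    positivity
  · nlinarith [Nat.cast_nonneg (α := ℝ) m]

theorem sum_hatWeight_mul_gridPoint (hm : 0 < m) (hx : |x| ≤ 1) :
    ∑ l : Fin (m + 1), hatWeight m x l * gridPoint m l = x := by
  have h := abs_le.1 hx
  have hm' : (0 : ℝ) < m := by exact_mod_cast hm
  have h2 : ∑ l : Fin (m + 1), hatWeight m x l * (l : ℕ) = m * (x + 1) / 2 := by
    rw [Fin.sum_univ_eq_sum_range fun l => hatWeight m x l * l]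
    refine (sum_hat m (y := m * (x + 1) / 2) ?_ ?_).2
    · have : 0 ≤ x + 1 := by linarith
      positivity
    · nlinarith
  calc ∑ l : Fin (m + 1), hatWeight m x l * gridPoint m l
      = 2 / m * ∑ l : Fin (m + 1), hatWeight m x l * (l : ℕ)
        - ∑ l : Fin (m + 1), hatWeight m x l := by
        rw [Finset.mul_sum, ← Finset.sum_sub_distrib]
        exact Finset.sum_congr rfl fun l _ => by rw [gridPoint]; ring
    _ = x := by
        rw [h2, sum_hatWeight hx]
        field_simp
        ring

theorem abs_gridPoint_sub_le (hm : 0 < m) {l : ℕ} (h : hatWeight m x l ≠ 0) :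
    |gridPoint m l - x| ≤ 2 / m := by
  have hm' : (0 : ℝ) < m := by exact_mod_cast hm
  have h1 : |m * (x + 1) / 2 - l| < 1 := by
    by_contra! h2
    exact h (max_eq_left (by linarith))
  have h2 : gridPoint m l - x = 2 / m * -(m * (x + 1) / 2 - l) := by
    rw [gridPoint]
    field_simp
    ring
  rw [h2, abs_mul, abs_neg, abs_of_pos (by positivity)]
  exact mul_le_of_le_one_right (by positivity) h1.le

theorem abs_gridPoint_le_one (hm : 0 < m) (l : Fin (m + 1)) : |gridPoint m l| ≤ 1 := by
  have hm' : (0 : ℝ) < m := by exact_mod_cast hm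
  have hl : ((l : ℕ) : ℝ) ≤ m := by exact_mod_cast Nat.lt_succ_iff.1 l.2
  have h1 : 2 * ((l : ℕ) : ℝ) / m ≤ 2 := by
    rw [div_le_iff₀ hm']
    linarith
  have h2 : 0 ≤ 2 * ((l : ℕ) : ℝ) / m := by positivity
  rw [abs_le, gridPoint]
  constructor <;> linarith

end Hat

/-- Rounding to a grid with `m + 1` points in each coordinate, independently for the
coordinates. -/
noncomputable def gridRounding (d m : ℕ) (hm : 0 < m) : Rounding d (Fin d → Fin (m + 1)) where
  p a := WithLp.toLp 2 fun i => gridPoint m (a i)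
  w v a := ∏ i, hatWeight m (v.1 i) (a i)
  measurable_w a := by
    refine Finset.measurable_prod _ fun i _ => measurable_const.max ?_
    exact ((((((InputVec.measurable_apply i).add_const _).const_mul _).div_const _).sub_const
      _).abs).const_sub _
  nonneg v a := Finset.prod_nonneg fun i _ => le_max_left _ _
  sum_eq_one v := sum_prod_eq_one (q := fun i (l : Fin (m + 1)) => hatWeight m (v.1 i) l)
    fun i => sum_hatWeight (v.abs_apply_le_one i)
  unbiased v c := (sum_prod_mul_eval (q := fun i (l : Fin (m + 1)) => hatWeight m (v.1 i) l)
    (fun i => sum_hatWeight (v.abs_apply_le_one i)) c fun l => gridPoint m l).trans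
      (sum_hatWeight_mul_gridPoint hm (v.abs_apply_le_one c))

theorem norm_le_of_abs_le {d : ℕ} {x : EuclideanSpace ℝ (Fin d)} {b : ℝ} (hb : 0 ≤ b)
    (h : ∀ i, |x i| ≤ b) : ‖x‖ ≤ √d * b := by
  refine abs_le_of_sq_le_sq' ?_ (by positivity) |>.2
  rw [EuclideanSpace.real_norm_sq_eq, mul_pow, Real.sq_sqrt (by positivity)]
  calc ∑ i, x i ^ 2 ≤ ∑ _i : Fin d, b ^ 2 :=
        Finset.sum_le_sum fun i _ => sq_le_sq' (abs_le.1 (h i)).1 (abs_le.1 (h i)).2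
    _ = d * b ^ 2 := by simp

/-- The protocol that ignores the inputs. -/
noncomputable def zeroProtocol (d n : ℕ) : SingleMessageProtocol d n where
  Message := Unit
  randomizer := Kernel.const _ (Measure.dirac ())
  aggregator _ := 0
  measurable_aggregator := measurable_const

theorem isShuffleDP_zeroProtocol (d n : ℕ) {ε δ : ℝ} (hε : 0 ≤ ε) :
    (zeroProtocol d n).IsShuffleDP ε δ := by
  intro x y _ U _
  have h : (zeroProtocol d n).shuffledMessages x U = (zeroProtocol d n).shuffledMessages y U := rfl
  rw [h]
  refine le_add_right (le_mul_of_one_le_left (by positivity) ?_)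
  rw [ENNReal.one_le_ofReal]
  exact Real.one_le_exp hε

theorem shuffle_univ_le_one {n : ℕ} {Z : Type*} [MeasurableSpace Z] (μ : Measure (Fin n → Z))
    [IsProbabilityMeasure μ] : shuffle μ Set.univ ≤ 1 := by
  have h := lintegral_shuffle μ (h := fun _ => 1) measurable_const
  simp only [lintegral_const, one_mul, measure_univ, mul_one, Finset.sum_const,
    Finset.card_univ, Fintype.card_perm, Fintype.card_fin, nsmul_eq_mul] at h
  rw [h]
  exact ENNReal.inv_mul_le_one _

theorem mse_zeroProtocol_le (d n : ℕ) {b : ℝ}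
    (hb : ∀ v : Fin n → InputVec d, ‖∑ i, (v i).1‖ ^ 2 ≤ b) :
    (zeroProtocol d n).mse ≤ ENNReal.ofReal b := by
  refine iSup_le fun v => ?_
  have h1 : ‖(0 : EuclideanSpace ℝ (Fin d)) - ∑ i, (v i).1‖ₑ ^ 2 ≤ ENNReal.ofReal b := by
    rw [zero_sub, enorm_neg, ← ofReal_norm, ← ENNReal.ofReal_pow (norm_nonneg _)]
    exact ENNReal.ofReal_le_ofReal (hb v)
  change ∫⁻ _, ‖(0 : EuclideanSpace ℝ (Fin d)) - ∑ i, (v i).1‖ₑ ^ 2 ∂_ ≤ _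
  rw [lintegral_const]
  refine (mul_le_mul' h1 ?_).trans_eq (mul_one _)
  exact shuffle_univ_le_one _

/-! ### The main theorem -/

/-- For few users, or in a high dimension, the error may be proportional to `d n`. -/
theorem exists_protocol_of_le {δ : ℝ} (hδ0 : 0 < δ) (hδ1 : δ < 1) {ε : ℝ} (hε : 0 ≤ ε) (d n : ℕ) :
    ∃ P : SingleMessageProtocol d n, P.IsShuffleDP ε δ ∧
      P.mse ≤ ENNReal.ofReal (96 / δ ^ 2 * (d * n)) := by
  rcases Nat.eq_zero_or_pos d with rfl | hd
  · refine ⟨zeroProtocol 0 n, isShuffleDP_zeroProtocol 0 n hε, mse_zeroProtocol_le 0 n fun v => ?_⟩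
    rw [Subsingleton.elim (∑ i, (v i).1) 0]
    simp
  have hd1 : (1 : ℝ) ≤ d := by exact_mod_cast hd
  have hδ2 : δ ^ 2 ≤ 1 := by nlinarith
  -- The threshold is the privacy condition `2B ≤ nγδ²` for `B = 2d`, `γ = 1/2`. With `r = s = 2√d`
  -- the error is `16n(4d + 2d) = 96dn`. Below the threshold, `n² ≤ 8dn/δ²`.
  rcases le_or_gt (8 * (d : ℝ)) (n * δ ^ 2) with h | h
  · have : Nonempty (Fin d × Bool) := ⟨(⟨0, hd⟩, true)⟩
    have hs : 1 ≤ √(d : ℝ) := Real.one_le_sqrt.2 hd1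
    have hr : ∀ (v : InputVec d) a, ‖(crossRounding d hd).p a - v.1‖ ≤ 2 * √d := by
      intro v a
      refine (norm_sub_le _ _).trans ?_
      have h1 := v.norm_le_one
      have h2 : ‖(crossRounding d hd).p a‖ = √d := by
        change ‖EuclideanSpace.single a.1 (boolSign a.2 * √d)‖ = _
        have h3 : |boolSign a.2| = 1 := by
          unfold boolSign
          split_ifs <;> simp
        rw [PiLp.norm_single, Real.norm_eq_abs, abs_mul, h3, one_mul,
          abs_of_nonneg (Real.sqrt_nonneg _)]
      linarith
    refine ⟨(crossRounding d hd).protocol n (1 / 2) (by norm_num) (by norm_num),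
      Rounding.isShuffleDP_protocol _ _ _ hε hδ0 ?_,
      (Rounding.mse_protocol_le _ le_rfl hr fun v a _ => hr v a).trans
        (ENNReal.ofReal_le_ofReal ?_)⟩
    · simp only [Fintype.card_prod, Fintype.card_fin, Fintype.card_bool]
      push_cast
      linarith
    · rw [mul_pow, Real.sq_sqrt (Nat.cast_nonneg d), div_mul_eq_mul_div (96 : ℝ),
        le_div_iff₀ (pow_pos hδ0 2)]
      have h1 : (0 : ℝ) ≤ d * n := by positivity
      nlinarith
  · refine ⟨zeroProtocol d n, isShuffleDP_zeroProtocol d n hε, mse_zeroProtocol_le d n fun v => ?_⟩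
    have h1 : ‖∑ i, (v i).1‖ ≤ n := by
      calc ‖∑ i, (v i).1‖ ≤ ∑ i, ‖(v i).1‖ := norm_sum_le _ _
        _ ≤ ∑ _i : Fin n, (1 : ℝ) := Finset.sum_le_sum fun i _ => (v i).norm_le_one
        _ = n := by simp
    have h2 : ‖∑ i, (v i).1‖ ^ 2 ≤ n ^ 2 := pow_le_pow_left₀ (norm_nonneg _) h1 2
    rw [div_mul_eq_mul_div, le_div_iff₀ (by positivity)]
    have h3 : (n : ℝ) * (n * δ ^ 2) ≤ n * (8 * d) := by gcongr
    have h4 := mul_le_mul_of_nonneg_right h2 (sq_nonneg δ)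
    have h5 : (0 : ℝ) ≤ d * n := by positivity
    linarith

/-- For many users, rounding to a grid is sufficiently precise. -/
theorem exists_protocol_of_lt {δ : ℝ} (hδ0 : 0 < δ) {ε : ℝ} (hε : 0 ≤ ε) {d n : ℕ}
    {t : ℝ} (ht0 : 0 < t) (ht : t ^ (d + 2) = n) (ht2 : 4 + 4 / δ ^ 2 < t ^ 2) :
    ∃ P : SingleMessageProtocol d n, P.IsShuffleDP ε δ ∧
      P.mse ≤ ENNReal.ofReal ((1024 + 128 / δ ^ 2) * (d * t ^ d)) := by
  have hδ2 : 0 < 4 / δ ^ 2 := by positivity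
  have ht' : 2 < t := by nlinarith
  -- The grid has `m + 1 = ⌊t⌋` points per axis, hence at most `t ^ d` in all; `t > 2` ensures `m ≥
  -- 1`.
  obtain ⟨m, hm⟩ : ∃ m, ⌊t⌋₊ = m + 1 :=
    Nat.exists_eq_succ_of_ne_zero (Nat.floor_pos.2 (by linarith)).ne'
  have hfl : ((m : ℝ) + 1) ≤ t := by
    have := Nat.floor_le ht0.le
    rw [hm] at this
    exact_mod_cast this
  have hfl2 : t < (m : ℝ) + 2 := by
    have := Nat.lt_floor_add_one t
    rw [hm] at this
    push_cast at this
    linarith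
  have hm0 : 0 < m := by
    rcases Nat.eq_zero_or_pos m with rfl | h
    · norm_num at hfl2
      linarith
    · exact h
  have hm1 : (1 : ℝ) ≤ m := by exact_mod_cast hm0
  have hn : (n : ℝ) = t ^ d * t ^ 2 := by rw [← ht, pow_add]
  have hn0 : (0 : ℝ) < n := by rw [← ht]; positivity
  set B : ℝ := ((m : ℝ) + 1) ^ d with hB
  have hBt : B ≤ t ^ d := pow_le_pow_left₀ (by positivity) hfl d
  have hB0 : 0 < B := by positivity
  have hcard : (Fintype.card (Fin d → Fin (m + 1)) : ℝ) = B := by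
    simp [hB]
  -- The least `γ` that privacy allows; `t ^ 2 ≥ 4 / δ ^ 2` will keep it at most `1 / 2`.
  set γ : ℝ := 2 * B / (n * δ ^ 2) with hγ
  have hγ0 : 0 ≤ γ := by positivity
  have hγn : n * γ = 2 * B / δ ^ 2 := by
    rw [hγ]
    field_simp
  have hγ2 : γ ≤ 1 / 2 := by
    rw [hγ, div_le_iff₀ (by positivity), hn]
    have h1 : 4 ≤ t ^ 2 * δ ^ 2 := by
      have h2 : 4 / δ ^ 2 ≤ t ^ 2 := by linarith
      rwa [div_le_iff₀ (by positivity)] at h2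
    have h3 : t ^ d * 4 ≤ t ^ d * (t ^ 2 * δ ^ 2) := by gcongr
    linarith
  have hr : ∀ (v : InputVec d) a, ‖(gridRounding d m hm0).p a - v.1‖ ≤ √d * 2 := by
    intro v a
    refine norm_le_of_abs_le (by norm_num) fun i => ?_
    change |gridPoint m (a i) - v.1 i| ≤ 2
    have h1 := abs_sub (gridPoint m (a i)) (v.1 i)
    linarith [abs_gridPoint_le_one hm0 (a i), v.abs_apply_le_one i]
  have hs : ∀ (v : InputVec d) a, (gridRounding d m hm0).w v a ≠ 0 →
      ‖(gridRounding d m hm0).p a - v.1‖ ≤ √d * (2 / m) := by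
    intro v a ha
    refine norm_le_of_abs_le (by positivity) fun i => ?_
    have ha' : ∏ i, hatWeight m (v.1 i) (a i) ≠ 0 := ha
    exact abs_gridPoint_sub_le hm0 (Finset.prod_ne_zero_iff.1 ha' i (Finset.mem_univ i))
  refine ⟨(gridRounding d m hm0).protocol n γ hγ0 (hγ2.trans (by norm_num)),
    Rounding.isShuffleDP_protocol _ _ _ hε hδ0 ?_,
    (Rounding.mse_protocol_le _ hγ2 hr hs).trans (ENNReal.ofReal_le_ofReal ?_)⟩
  · rw [hcard, hγn, div_mul_cancel₀ _ (by positivity)]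
  · have h1 : n * (2 / (m : ℝ)) ^ 2 ≤ 64 * t ^ d := by
      -- Here `t < m + 2 ≤ 4m`, as `m ≥ 1`.
      have h2 : (2 / (m : ℝ)) ≤ 8 / t := by
        rw [div_le_div_iff₀ (by positivity) ht0]
        linarith
      calc n * (2 / (m : ℝ)) ^ 2 ≤ n * (8 / t) ^ 2 := by gcongr
        _ = 64 * t ^ d := by
          rw [hn]
          field_simp
          norm_num
    calc n * (16 * ((√d * (2 / m)) ^ 2 + γ * (√d * 2) ^ 2))
        = 16 * d * (n * (2 / (m : ℝ)) ^ 2) + 64 * d * (n * γ) := by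
          rw [mul_pow, mul_pow, Real.sq_sqrt (by positivity)]
          ring
      _ ≤ 16 * d * (64 * t ^ d) + 64 * d * (2 * t ^ d / δ ^ 2) := by
          rw [hγn]
          gcongr
      _ = (1024 + 128 / δ ^ 2) * (d * t ^ d) := by ring

/-- Since the constant may depend on `δ`, and `ε < 1`, it suffices to construct protocols with error
`O_δ(d n^{d/(d+2)})`; their total variation guarantee `δ` is that of `(0, δ)`-DP. -/
theorem mainTheorem3 (δ : ℝ) (hδ0 : 0 < δ) (hδ1 : δ < 1) :
    ∃ C : ℝ, 0 < C ∧
      ∀ (ε : ℝ), 0 < ε → ε < 1 → ∀ d n : ℕ,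
        ∃ P : SingleMessageProtocol d n,
          P.IsShuffleDP ε δ ∧
          P.mse ≤ ENNReal.ofReal
            (C * (d * (n : ℝ) ^ ((d : ℝ) / (d + 2)) * ε ^ (-(4 : ℝ) / (d + 2)))) := by
  set C₁ : ℝ := 96 / δ ^ 2 * (4 + 4 / δ ^ 2) with hC₁
  set C₂ : ℝ := 1024 + 128 / δ ^ 2 with hC₂
  have hC₁0 : 0 < C₁ := by positivity
  have hC₂0 : 0 < C₂ := by positivity
  refine ⟨C₁ + C₂, by positivity, fun ε hε0 hε1 d n => ?_⟩
  set t : ℝ := (n : ℝ) ^ ((1 : ℝ) / (d + 2)) with ht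
  have ht0 : 0 ≤ t := by positivity
  have htn : t ^ (d + 2) = n := by
    rw [ht, ← Real.rpow_natCast, ← Real.rpow_mul (by positivity)]
    push_cast
    rw [one_div_mul_cancel (by positivity), Real.rpow_one]
  have htd : (n : ℝ) ^ ((d : ℝ) / (d + 2)) = t ^ d := by
    rw [ht, ← Real.rpow_natCast, ← Real.rpow_mul (by positivity)]
    congr 1
    ring
  have hε : 1 ≤ ε ^ (-(4 : ℝ) / (d + 2)) :=
    Real.one_le_rpow_of_pos_of_le_one_of_nonpos hε0 hε1.le
      (div_nonpos_of_nonpos_of_nonneg (by norm_num) (by positivity))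
  have hbound : ∀ {x : ℝ}, x ≤ (C₁ + C₂) * (d * t ^ d) → ENNReal.ofReal x ≤ ENNReal.ofReal
      ((C₁ + C₂) * (d * (n : ℝ) ^ ((d : ℝ) / (d + 2)) * ε ^ (-(4 : ℝ) / (d + 2)))) := by
    intro x hx
    refine ENNReal.ofReal_le_ofReal (hx.trans ?_)
    rw [htd]
    exact mul_le_mul_of_nonneg_left (le_mul_of_one_le_right (by positivity) hε) (by positivity)
  -- In the first case, which includes `n = 0`, `n = t ^ d * t ^ 2` is at most a constant times `t ^
  -- d`. A grid would not do there in high dimension: it has at least `2 ^ d` points.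
  rcases le_or_gt (t ^ 2) (4 + 4 / δ ^ 2) with h | h
  · obtain ⟨P, hP, hmse⟩ := exists_protocol_of_le hδ0 hδ1 hε0.le d n
    refine ⟨P, hP, hmse.trans (hbound ?_)⟩
    calc 96 / δ ^ 2 * (d * (n : ℝ)) = 96 / δ ^ 2 * (d * (t ^ d * t ^ 2)) := by
          rw [← htn, pow_add]
      _ ≤ 96 / δ ^ 2 * (d * (t ^ d * (4 + 4 / δ ^ 2))) := by gcongr
      _ = C₁ * (d * t ^ d) := by rw [hC₁]; ring
      _ ≤ (C₁ + C₂) * (d * t ^ d) := by gcongr; linarith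
  · have ht1 : 0 < t := by
      rcases ht0.eq_or_lt with h0 | h0
      · have : 0 < 4 / δ ^ 2 := by positivity
        rw [← h0] at h
        norm_num at h
        linarith
      · exact h0
    obtain ⟨P, hP, hmse⟩ := exists_protocol_of_lt hδ0 hε0.le ht1 htn h
    refine ⟨P, hP, hmse.trans (hbound ?_)⟩
    exact mul_le_mul_of_nonneg_right (by linarith) (by positivity)
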